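/- Let $d\in\mathbb{N}$ and $\psi>0$. Let $\mathbb{S}$ be any set of Borel probability measures on $\mathbb{R}^d$ that have a density with respect to Lebesgue measure. For $P\in\mathbb{S}$ with density $p$ and $v\in S^{d-1}$, let $$Rp(t,v)=\int_{v^\perp}p(tv+y)\,dy,\qquad t\in\mathbb{R},$$ be the Radon transform of $p$, and let $P_v$ be the measure on $\mathbb{R}$ with density $Rp(\cdot,v)$. For $P,Q\in\mathbb{S}$ put $$SW^2(P,Q)=\int_{S^{d-1}}W^2(P_v,Q_v)\,dv\in[0,\infty],\qquad W^2(\mu,\nu)=\inf_{\gamma}\int_{\mathbb{R}\times\mathbb{R}}|x-y|^2\,d\gamma(x,y),$$ where $dv$ is the surface measure on the sphere and $\gamma$ runs over the couplings of $\mu$ and $\nu$. Let $$\kappa(P,Q)=\exp\bigl(-\psi\,SW^2(P,Q)\bigr),\qquad \exp(-\infty):=0,$$ be the sliced Wasserstein Gaussian kernel on $\mathbb{S}\times\mathbb{S}$. Then: 1. $\kappa$ is positive definite: it is symmetric, and $\sum_{i=1}^N\sum_{j=1}^N a_ia_j\,\kappa(s_i,s_j)\ge 0$ for all $N\in\mathbb{N}$,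 $s_1,\dots,s_N\in\mathbb{S}$ and $a_1,\dots,a_N\in\mathbb{R}$. 2. $\kappa$ induces a unique reproducing kernel Hilbert space: there is a real Hilbert space of functions on $\mathbb{S}$, with continuous point evaluations, whose reproducing kernel is $\kappa$; and between any two such spaces there is a linear isometric isomorphism that sends each element to an element representing the same function on $\mathbb{S}$. -/

import Mathlib

open MeasureTheory
open scoped ENNReal

noncomputable section

namespace SWG

/-- Borel probability measures on `ℝ^d` that have a density with respect to Lebesgue measure. -/
abbrev ContinuousProbabilityMeasure (d : ℕ) : Type :=
  {P : ProbabilityMeasure (EuclideanSpace ℝ (Fin d)) //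
    (P : Measure (EuclideanSpace ℝ (Fin d))) ≪ volume}

/-- The probability density function of `P` with respect to Lebesgue measure. -/
def density {d : ℕ} (P : ContinuousProbabilityMeasure d) : EuclideanSpace ℝ (Fin d) → ℝ≥0∞ :=
  (P.1 : Measure (EuclideanSpace ℝ (Fin d))).rnDeriv volume

/-- The Radon transform of `p` in the unit direction `v`, at offset `t`: the integral of `p` over
the affine hyperplane `{x | ⟪x, v⟫ = t} = t v + v^⊥`, with respect to the Lebesgue measure of that
hyperplane. -/
def radonTransform {d : ℕ} (p : EuclideanSpace ℝ (Fin d) → ℝ≥0∞)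
    (v : EuclideanSpace ℝ (Fin d)) (t : ℝ) : ℝ≥0∞ :=
  ∫⁻ y : (Submodule.span ℝ {v})ᗮ, p (t • v + (y : EuclideanSpace ℝ (Fin d)))

/-- The measure on the real line whose density is the Radon transform of the density of `P` in the
direction `v`. -/
def slice {d : ℕ} (P : ContinuousProbabilityMeasure d) (v : EuclideanSpace ℝ (Fin d)) :
    Measure ℝ :=
  volume.withDensity (radonTransform (density P) v)

/-- `γ` is a coupling (transport plan) of `μ` and `ν`. -/
def IsCoupling (γ : Measure (ℝ × ℝ)) (μ ν : Measure ℝ) : Prop :=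
  γ.map Prod.fst = μ ∧ γ.map Prod.snd = ν

/-- The squared `L²` Wasserstein distance of two measures on the real line, with values in
`[0, ∞]`. -/
def wassersteinSq (μ ν : Measure ℝ) : ℝ≥0∞ :=
  ⨅ (γ : Measure (ℝ × ℝ)) (_ : IsCoupling γ μ ν), ∫⁻ z, edist z.1 z.2 ^ 2 ∂γ

/-- The squared sliced Wasserstein distance, with values in `[0, ∞]`; the integral is with respect
to the surface measure of the unit sphere. -/
def slicedWassersteinSq {d : ℕ} (P Q : ContinuousProbabilityMeasure d) : ℝ≥0∞ :=
  ∫⁻ v : Metric.sphere (0 : EuclideanSpace ℝ (Fin d)) 1,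
    wassersteinSq (slice P (v : EuclideanSpace ℝ (Fin d)))
      (slice Q (v : EuclideanSpace ℝ (Fin d)))
    ∂(volume : Measure (EuclideanSpace ℝ (Fin d))).toSphere

open Classical in
/-- The sliced Wasserstein Gaussian kernel `exp (-ψ SW²(P, Q))`, with `exp (-∞) = 0`. -/
def kernel {d : ℕ} (ψ : ℝ) (P Q : ContinuousProbabilityMeasure d) : ℝ :=
  if slicedWassersteinSq P Q = ∞ then 0
  else Real.exp (-ψ * (slicedWassersteinSq P Q).toReal)

/-- Real positive definite kernels on a set `X`. -/
def IsPositiveDefiniteKernel {X : Type*} (k : X → X → ℝ) : Prop :=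
  (∀ s t, k s t = k t s) ∧
    ∀ (N : ℕ) (s : Fin N → X) (a : Fin N → ℝ), 0 ≤ ∑ i, ∑ j, a i * a j * k (s i) (s j)

/-- The reproducing kernel of the Hilbert space `H` of real functions on `X` is `k`. -/
def HasReproducingKernel {X : Type*} (H : Type*) [NormedAddCommGroup H] [InnerProductSpace ℝ H]
    [CompleteSpace H] [RKHS ℝ H X ℝ] (k : X → X → ℝ) : Prop :=
  ∀ s t, RKHS.kernel H s t 1 = k s t

end SWG

end

/-!
The squared sliced Wasserstein distance is a squared `L²` distance, so that `exp (-ψ SW²)` is the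
Gaussian kernel of a Hilbert space, up to the possibility that distances are infinite.

*The embedding.* By Tonelli in the splitting `ℝ v ⊕ vᗮ`, the slice of `P` in a unit direction `v`
is the law of `⟪v, ·⟫` under `P` (`slice_eq_map`); it is a probability measure, and its
distribution function is measurable in `v`. On the real line the optimal coupling is the monotone
one, whence `W²(μ, ν) = ∫₀¹ |q_μ - q_ν|²` for the quantile functions
(`wassersteinSq_eq_lintegral_quantile`). The proof needs no moments: the cost of a plan `γ` is the
integral over `(s, t)` of the masses of the quadrants `{x > max s t, y ≤ min s t}` and
`{y > max s t, x ≤ min s t}`, and the monotone plan minimizes each of these masses. Therefore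
`SW²(P, Q)` is the squared `L²` distance, with values in `[0, ∞]`, of the measurable functions
`(v, u) ↦ q_{P_v}(u)` and `(v, u) ↦ q_{Q_v}(u)` on the product of the sphere and `(0, 1)`.

*Positive definiteness.* In a Hilbert space the Gaussian kernel is positive definite by Schur's
product theorem and the exponential series (`sum_gaussian_nonneg`). The functions above need not
be square integrable, but their truncations to `[-n, n]` are, because the product measure is
finite. The squared distances of the truncations increase to the given ones, and positive
definiteness survives the limit, with `exp (-∞) = 0` for infinite distances
(`sum_expNeg_lintegral_nonneg`).

*Hilbert space.* Existence is Moore's theorem. For uniqueness, the combinations of kernel functions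
are dense, and their norms depend on the kernel only, so matching kernel functions extends to an
isometry; it preserves point values by the reproducing property.
-/

open MeasureTheory
open scoped ENNReal

noncomputable section

namespace SWG

/-! ### Slices as one-dimensional marginals -/

/-- The slice in a unit direction `v` is the law of the coordinate `⟪v, ·⟫`. This is Tonelli's
theorem in the orthogonal splitting of the space into the line of `v` and `vᗮ`. -/
lemma slice_eq_map {d : ℕ} (P : ContinuousProbabilityMeasure d) {v : EuclideanSpace ℝ (Fin d)}
    (hv : ‖v‖ = 1) :
    slice P v = (P.1 : Measure (EuclideanSpace ℝ (Fin d))).map (fun x => inner ℝ v x) := by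
  let E := EuclideanSpace ℝ (Fin d)
  let K : Submodule ℝ E := Submodule.span ℝ {v}
  have hsp : MeasurePreserving (LinearIsometryEquiv.toSpanUnitSingleton (𝕜 := ℝ) v hv)
      volume volume := LinearIsometryEquiv.measurePreserving _
  have hT : MeasurePreserving
      (fun z : ℝ × Kᗮ => z.1 • v + (z.2 : E)) (volume.prod volume) volume := by
    have h1 := (hsp.prod (MeasurePreserving.id (volume : Measure Kᗮ)))
    have h2 := K.orthogonalDecomposition.symm.measurePreserving.comp
      ((WithLp.volume_preserving_toLp K Kᗮ).comp h1)
    exact h2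
  have hp : Measurable (density P) := Measure.measurable_rnDeriv _ _
  have hP : (volume : Measure E).withDensity (density P) = P.1 :=
    Measure.withDensity_rnDeriv_eq _ _ P.2
  have hin : Measurable (fun x : E => inner ℝ v x) := by fun_prop
  ext A hA
  have hmeas : Measurable ((((fun x : E => inner ℝ v x) ⁻¹' A)).indicator (density P)) :=
    hp.indicator (hin hA)
  have hmeas' : Measurable fun z : ℝ × Kᗮ =>
      ((fun x : E => inner ℝ v x) ⁻¹' A).indicator (density P) (z.1 • v + (z.2 : E)) :=
    hmeas.comp hT.measurable
  rw [Measure.map_apply hin hA, slice, withDensity_apply _ hA, ← hP,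
    withDensity_apply _ (hin hA), ← lintegral_indicator (hin hA), ← hT.lintegral_comp hmeas,
    lintegral_prod _ hmeas'.aemeasurable, ← lintegral_indicator hA]
  refine lintegral_congr fun t => ?_
  have hz : ∀ y : Kᗮ, inner ℝ v (t • v + (y : E)) = t := fun y => by
    have : inner ℝ v (y : E) = 0 :=
      Submodule.mem_orthogonal_singleton_iff_inner_right.1 y.2
    rw [inner_add_right, inner_smul_right, this, real_inner_self_eq_norm_sq, hv]; simp
  by_cases ht : t ∈ A
  · simp only [Set.indicator, Set.mem_preimage, hz, ht, if_true]
    rfl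
  · simp only [Set.indicator, Set.mem_preimage, hz, ht, if_false, lintegral_zero]

lemma isProbabilityMeasure_slice {d : ℕ} (P : ContinuousProbabilityMeasure d)
    (v : Metric.sphere (0 : EuclideanSpace ℝ (Fin d)) 1) :
    IsProbabilityMeasure (slice P (v : EuclideanSpace ℝ (Fin d))) := by
  rw [slice_eq_map P (norm_eq_of_mem_sphere v)]
  exact Measure.isProbabilityMeasure_map (by fun_prop)

lemma measurable_slice_Iic {d : ℕ} (P : ContinuousProbabilityMeasure d) (t : ℝ) :
    Measurable fun v : Metric.sphere (0 : EuclideanSpace ℝ (Fin d)) 1 =>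
      slice P (v : EuclideanSpace ℝ (Fin d)) (Set.Iic t) := by
  have hS : MeasurableSet {z : Metric.sphere (0 : EuclideanSpace ℝ (Fin d)) 1 ×
      EuclideanSpace ℝ (Fin d) | inner ℝ (z.1 : EuclideanSpace ℝ (Fin d)) z.2 ≤ t} :=
    (isClosed_le (by fun_prop) continuous_const).measurableSet
  convert measurable_measure_prodMk_left (ν := (P.1 : Measure (EuclideanSpace ℝ (Fin d)))) hS
    using 2 with v
  rw [slice_eq_map P (norm_eq_of_mem_sphere v), Measure.map_apply (by fun_prop) measurableSet_Iic]
  rfl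

/-! ### The Wasserstein distance on the real line -/

/-- The quantile function of `μ`, the generalized inverse of its distribution function on `(0, 1)`;
it is set to `0` off `(0, 1)`. -/
def quantile (μ : Measure ℝ) (u : ℝ) : ℝ :=
  if u ∈ Set.Ioo (0 : ℝ) 1 then sInf {x | u ≤ ProbabilityTheory.cdf μ x} else 0

lemma quantile_le_iff (μ : Measure ℝ) {u : ℝ} (hu : u ∈ Set.Ioo (0 : ℝ) 1) (x : ℝ) :
    quantile μ u ≤ x ↔ u ≤ ProbabilityTheory.cdf μ x := by
  have hne : {x | u ≤ ProbabilityTheory.cdf μ x}.Nonempty :=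
    (((ProbabilityTheory.tendsto_cdf_atTop μ).eventually (eventually_gt_nhds hu.2)).exists).imp
      fun _ h => h.le
  obtain ⟨b, hb⟩ :=
    ((ProbabilityTheory.tendsto_cdf_atBot μ).eventually (eventually_lt_nhds hu.1)).exists
  have hbdd : BddBelow {x | u ≤ ProbabilityTheory.cdf μ x} :=
    ⟨b, fun y hy => le_of_not_gt fun hyb =>
      absurd (hy.trans (ProbabilityTheory.monotone_cdf μ hyb.le)) (not_le.2 hb)⟩
  rw [quantile, if_pos hu]
  refine ⟨fun h => ?_, fun h => csInf_le hbdd h⟩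
  -- By right continuity it suffices to compare at the points `y > x`.
  refine ge_of_tendsto (((ProbabilityTheory.cdf μ).right_continuous x).mono_left
    (nhdsWithin_mono x Set.Ioi_subset_Ici_self)) ?_
  filter_upwards [self_mem_nhdsWithin] with y hy
  obtain ⟨z, hz, hzy⟩ := exists_lt_of_csInf_lt hne (h.trans_lt hy)
  exact hz.trans (ProbabilityTheory.monotone_cdf μ hzy.le)

lemma measurable_quantile_family {Ω : Type*} [MeasurableSpace Ω] (μ : Ω → Measure ℝ)
    [∀ ω, IsProbabilityMeasure (μ ω)] (hμ : ∀ x, Measurable fun ω => μ ω (Set.Iic x)) :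
    Measurable fun z : Ω × ℝ => quantile (μ z.1) z.2 := by
  refine measurable_of_Iic fun x => ?_
  have hF : Measurable fun ω => ProbabilityTheory.cdf (μ ω) x := by
    simp_rw [ProbabilityTheory.cdf_eq_real]
    exact (hμ x).ennreal_toReal
  have hI : MeasurableSet {z : Ω × ℝ | z.2 ∈ Set.Ioo (0 : ℝ) 1} :=
    measurable_snd measurableSet_Ioo
  have : (fun z : Ω × ℝ => quantile (μ z.1) z.2) ⁻¹' Set.Iic x =
      {z | z.2 ∈ Set.Ioo (0 : ℝ) 1} ∩ {z | z.2 ≤ ProbabilityTheory.cdf (μ z.1) x} ∪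
      {z | z.2 ∈ Set.Ioo (0 : ℝ) 1}ᶜ ∩ {_z | 0 ≤ x} := by
    ext z
    by_cases hz : z.2 ∈ Set.Ioo (0 : ℝ) 1
    · simp only [Set.mem_preimage, Set.mem_Iic, quantile_le_iff _ hz]
      simp only [Set.mem_union, Set.mem_inter_iff, Set.mem_ofPred_eq, hz, Set.mem_compl_iff]
      simp
    · simp only [Set.mem_preimage, Set.mem_Iic, quantile, Set.mem_union,
        Set.mem_inter_iff, Set.mem_ofPred_eq, hz, Set.mem_compl_iff]
      simp
  rw [this]
  exact (hI.inter (measurableSet_le measurable_snd (hF.comp measurable_fst))).union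
    (hI.compl.inter (MeasurableSet.const _))

lemma measurable_quantile (μ : Measure ℝ) [IsProbabilityMeasure μ] : Measurable (quantile μ) :=
  (measurable_quantile_family (fun _ : Unit => μ) fun _ => measurable_const).comp
    (measurable_const (a := ()) |>.prodMk measurable_id)

lemma map_quantile (μ : Measure ℝ) [IsProbabilityMeasure μ] :
    (volume.restrict (Set.Ioo (0 : ℝ) 1)).map (quantile μ) = μ := by
  have : IsFiniteMeasure ((volume.restrict (Set.Ioo (0 : ℝ) 1)).map (quantile μ)) := inferInstance
  refine Measure.ext_of_Iic _ _ fun x => ?_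
  rw [Measure.map_apply (measurable_quantile μ) measurableSet_Iic,
    Measure.restrict_apply (measurable_quantile μ measurableSet_Iic),
    ← ProbabilityTheory.ofReal_cdf]
  have : quantile μ ⁻¹' Set.Iic x ∩ Set.Ioo 0 1 =
      Set.Ioo 0 1 ∩ Set.Iic (ProbabilityTheory.cdf μ x) := by
    ext u
    simp only [Set.mem_inter_iff, Set.mem_preimage, Set.mem_Iic]
    exact ⟨fun h => ⟨h.2, (quantile_le_iff μ h.2 x).1 h.1⟩,
      fun h => ⟨(quantile_le_iff μ h.1 x).2 h.2, h.1⟩⟩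
  rw [this, measure_congr ((Ioo_ae_eq_Ioc (μ := volume) (a := (0:ℝ)) (b := 1)).inter
    (Filter.EventuallyEq.refl _ (Set.Iic (ProbabilityTheory.cdf μ x)))), Set.Ioc_inter_Iic,
    Real.volume_Ioc, min_eq_right (ProbabilityTheory.cdf_le_one μ x), sub_zero]

lemma measurableSet_le_and_lt {α : Type*} [MeasurableSpace α] {f g h k : α → ℝ}
    (hf : Measurable f) (hg : Measurable g) (hh : Measurable h) (hk : Measurable k) :
    MeasurableSet {a | f a ≤ g a ∧ h a < k a} :=
  (measurableSet_le hf hg).inter (measurableSet_lt hh hk)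

/-- The square over `[y, x)` has area `(x - y)₊²`. -/
lemma edist_sq_eq_volume (x y : ℝ) :
    edist x y ^ 2 = (volume : Measure (ℝ × ℝ)) (Set.Ico y x ×ˢ Set.Ico y x) +
      (volume : Measure (ℝ × ℝ)) (Set.Ico x y ×ˢ Set.Ico x y) := by
  rw [Measure.volume_eq_prod, Measure.prod_prod, Measure.prod_prod, Real.volume_Ico,
    Real.volume_Ico, edist_dist, Real.dist_eq]
  rcases le_total x y with h | h
  · rw [ENNReal.ofReal_of_nonpos (sub_nonpos.2 h), abs_of_nonpos (sub_nonpos.2 h)]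
    simp [sq]
  · rw [ENNReal.ofReal_of_nonpos (sub_nonpos.2 h), abs_of_nonneg (sub_nonneg.2 h)]
    simp [sq]

/-- The transport cost of a plan, written in terms of the masses that the plan gives to quadrants:
by Tonelli, each point `(x, y)` contributes the areas of `edist_sq_eq_volume`. -/
lemma lintegral_edist_sq (γ : Measure (ℝ × ℝ)) [SFinite γ] :
    ∫⁻ z, edist z.1 z.2 ^ 2 ∂γ = ∫⁻ p : ℝ × ℝ,
      (γ {z | z.2 ≤ min p.1 p.2 ∧ max p.1 p.2 < z.1} +
        γ {z | z.1 ≤ min p.1 p.2 ∧ max p.1 p.2 < z.2}) := by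
  have hA : MeasurableSet {w : (ℝ × ℝ) × (ℝ × ℝ) |
      w.1.2 ≤ min w.2.1 w.2.2 ∧ max w.2.1 w.2.2 < w.1.1} :=
    measurableSet_le_and_lt (by fun_prop) (by fun_prop) (by fun_prop) (by fun_prop)
  have hB : MeasurableSet {w : (ℝ × ℝ) × (ℝ × ℝ) |
      w.1.1 ≤ min w.2.1 w.2.2 ∧ max w.2.1 w.2.2 < w.1.2} :=
    measurableSet_le_and_lt (by fun_prop) (by fun_prop) (by fun_prop) (by fun_prop)
  have key : ∀ {s : Set ((ℝ × ℝ) × (ℝ × ℝ))}, MeasurableSet s →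
      ∫⁻ z, (volume : Measure (ℝ × ℝ)) (Prod.mk z ⁻¹' s) ∂γ =
        ∫⁻ p : ℝ × ℝ, γ ((fun z => (z, p)) ⁻¹' s) := fun hs => by
    rw [← Measure.prod_apply hs, ← Measure.prod_apply_symm hs]
  have e1 : ∀ x y : ℝ, Set.Ico y x ×ˢ Set.Ico y x =
      {p : ℝ × ℝ | y ≤ min p.1 p.2 ∧ max p.1 p.2 < x} := fun x y => by
    ext p
    simp only [Set.mem_prod, Set.mem_Ico, Set.mem_ofPred_eq, le_min_iff, max_lt_iff]
    tauto
  simp_rw [edist_sq_eq_volume, e1]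
  exact (lintegral_add_left (measurable_measure_prodMk_left hA) _).trans
    ((congrArg₂ _ (key hA) (key hB)).trans
      (lintegral_add_left (measurable_measure_prodMk_right hA) _).symm)

/-- Every coupling gives the quadrant `{x > b, y ≤ a}` at least the mass `ν (-∞, a] - μ (-∞, b]`. -/
lemma sub_le_coupling_quadrant {γ : Measure (ℝ × ℝ)} {μ ν : Measure ℝ} (h : IsCoupling γ μ ν)
    (a b : ℝ) : ν (Set.Iic a) - μ (Set.Iic b) ≤ γ {z | z.2 ≤ a ∧ b < z.1} := by
  rw [tsub_le_iff_right, ← h.1, ← h.2, Measure.map_apply measurable_fst measurableSet_Iic,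
    Measure.map_apply measurable_snd measurableSet_Iic]
  refine (measure_mono fun z hz => ?_).trans (measure_union_le _ _)
  rcases le_or_gt z.1 b with h | h
  · exact Or.inr h
  · exact Or.inl ⟨hz, h⟩

lemma IsCoupling.swap {γ : Measure (ℝ × ℝ)} {μ ν : Measure ℝ} (h : IsCoupling γ μ ν) :
    IsCoupling (γ.map Prod.swap) ν μ := by
  constructor
  · rw [Measure.map_map measurable_fst measurable_swap]; exact h.2
  · rw [Measure.map_map measurable_snd measurable_swap]; exact h.1

/-- The monotone coupling attains the bound of `sub_le_coupling_quadrant`. -/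
lemma volume_quantile_quadrant_le (μ ν : Measure ℝ) [IsProbabilityMeasure μ]
    [IsProbabilityMeasure ν] (a b : ℝ) :
    (volume.restrict (Set.Ioo (0 : ℝ) 1)) {u | quantile ν u ≤ a ∧ b < quantile μ u} ≤
      ν (Set.Iic a) - μ (Set.Iic b) := by
  have hm : MeasurableSet {u | quantile ν u ≤ a ∧ b < quantile μ u} :=
    (measurable_quantile ν measurableSet_Iic).inter (measurable_quantile μ measurableSet_Ioi)
  rw [Measure.restrict_apply hm, ← ProbabilityTheory.ofReal_cdf, ← ProbabilityTheory.ofReal_cdf,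
    ← ENNReal.ofReal_sub _ (ProbabilityTheory.cdf_nonneg μ b), ← Real.volume_Ioc]
  refine measure_mono fun u hu => ⟨?_, (quantile_le_iff ν hu.2 a).1 hu.1.1⟩
  exact lt_of_not_ge fun h => absurd ((quantile_le_iff μ hu.2 b).2 h) (not_le.2 hu.1.2)

/-- On the line the squared Wasserstein distance is the squared `L²` distance of the quantile
functions, including the case where both are infinite. -/
theorem wassersteinSq_eq_lintegral_quantile (μ ν : Measure ℝ) [IsProbabilityMeasure μ]
    [IsProbabilityMeasure ν] :
    wassersteinSq μ ν =
      ∫⁻ u in Set.Ioo (0 : ℝ) 1, edist (quantile μ u) (quantile ν u) ^ 2 := by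
  have hq : Measurable fun u => (quantile μ u, quantile ν u) :=
    (measurable_quantile μ).prodMk (measurable_quantile ν)
  set γ₀ := (volume.restrict (Set.Ioo (0 : ℝ) 1)).map fun u => (quantile μ u, quantile ν u)
    with hγ₀
  have hcost : ∫⁻ z, edist z.1 z.2 ^ 2 ∂γ₀ =
      ∫⁻ u in Set.Ioo (0 : ℝ) 1, edist (quantile μ u) (quantile ν u) ^ 2 :=
    lintegral_map (by fun_prop) hq
  have hc : IsCoupling γ₀ μ ν := by
    constructor
    · rw [hγ₀, Measure.map_map measurable_fst hq]; exact map_quantile μ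
    · rw [hγ₀, Measure.map_map measurable_snd hq]; exact map_quantile ν
  rw [← hcost]
  refine le_antisymm (iInf₂_le γ₀ hc) (le_iInf₂ fun γ hγ => ?_)
  -- The definition of a coupling does not ask for finiteness; the marginals force it.
  have : IsFiniteMeasure γ := by
    have : IsFiniteMeasure (γ.map Prod.fst) := by rw [hγ.1]; infer_instance
    exact Measure.isFiniteMeasure_of_map measurable_fst.aemeasurable
  -- The monotone coupling is optimal quadrant by quadrant.
  rw [lintegral_edist_sq γ₀, lintegral_edist_sq γ]
  refine lintegral_mono fun p => add_le_add ?_ ?_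
  · rw [hγ₀, Measure.map_apply hq (measurableSet_le_and_lt (by fun_prop) (by fun_prop)
      (by fun_prop) (by fun_prop))]
    exact (volume_quantile_quadrant_le μ ν _ _).trans (sub_le_coupling_quadrant hγ _ _)
  · rw [hγ₀, Measure.map_apply hq (measurableSet_le_and_lt (by fun_prop) (by fun_prop)
      (by fun_prop) (by fun_prop))]
    refine (volume_quantile_quadrant_le ν μ _ _).trans
      ((sub_le_coupling_quadrant hγ.swap _ _).trans_eq ?_)
    rw [Measure.map_apply measurable_swap (measurableSet_le_and_lt (by fun_prop) (by fun_prop)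
      (by fun_prop) (by fun_prop))]
    rfl

/-! ### Gaussian kernels -/

section Gaussian

open Filter Topology

/-- The Gaussian kernel as a function of a squared distance in `[0, ∞]`, with `exp (-∞) = 0`. -/
def expNeg (ψ : ℝ) (c : ℝ≥0∞) : ℝ :=
  open Classical in if c = ∞ then 0 else Real.exp (-ψ * c.toReal)

lemma tendsto_expNeg {ψ : ℝ} (hψ : 0 < ψ) {c : ℕ → ℝ≥0∞} {C : ℝ≥0∞} (hc : ∀ n, c n ≠ ∞)
    (h : Tendsto c atTop (𝓝 C)) : Tendsto (fun n => expNeg ψ (c n)) atTop (𝓝 (expNeg ψ C)) := by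
  simp only [expNeg, hc, if_false]
  by_cases hC : C = ∞
  · rw [if_pos hC]
    have h1 : Tendsto (fun n => (c n).toReal) atTop atTop := by
      refine tendsto_atTop.2 fun b => ?_
      filter_upwards [h.eventually (lt_mem_nhds (hC ▸ ENNReal.ofReal_lt_top (r := b)))] with n hn
      exact (ENNReal.ofReal_le_iff_le_toReal (hc n)).1 hn.le
    exact Real.tendsto_exp_atBot.comp (h1.const_mul_atTop_of_neg (neg_lt_zero.2 hψ))
  · rw [if_neg hC]
    exact (Real.continuous_exp.tendsto _).comp
      (((ENNReal.tendsto_toReal hC).comp h).const_mul (-ψ))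

/-- Entrywise powers of a Gram matrix are positive semidefinite, by Schur's product theorem. -/
lemma posSemidef_inner_pow {F ι : Type*} [NormedAddCommGroup F] [InnerProductSpace ℝ F] [Finite ι]
    (x : ι → F) (k : ℕ) : (Matrix.of fun i j => inner ℝ (x i) (x j) ^ k).PosSemidef := by
  induction k with
  | zero =>
    have : (Matrix.of fun i j => inner ℝ (x i) (x j) ^ 0) =
        Matrix.gram ℝ (fun _ : ι => (1 : ℝ)) := by
      ext i j
      simp [Matrix.gram]
    rw [this]
    exact Matrix.posSemidef_gram ℝ _
  | succ k ih =>
    have : (Matrix.of fun i j => inner ℝ (x i) (x j) ^ (k + 1)) =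
        (Matrix.of fun i j => inner ℝ (x i) (x j) ^ k).hadamard (Matrix.gram ℝ x) := by
      ext i j
      simp [Matrix.gram, pow_succ]
    rw [this]
    exact ih.hadamard (Matrix.posSemidef_gram ℝ x)

/-- The Gaussian kernel of a real inner product space is positive definite: up to the rescaling
`a i ↦ a i * exp (-ψ ‖x i‖²)` of the coefficients it is `exp (2 ψ ⟪x i, x j⟫)`, a power series in
the Gram matrix with nonnegative coefficients. -/
lemma sum_gaussian_nonneg {F ι : Type*} [NormedAddCommGroup F] [InnerProductSpace ℝ F] [Fintype ι]
    {ψ : ℝ} (hψ : 0 ≤ ψ) (x : ι → F) (a : ι → ℝ) :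
    0 ≤ ∑ i, ∑ j, a i * a j * Real.exp (-ψ * ‖x i - x j‖ ^ 2) := by
  set b : ι → ℝ := fun i => a i * Real.exp (-ψ * ‖x i‖ ^ 2) with hb
  have h1 : ∀ i j, a i * a j * Real.exp (-ψ * ‖x i - x j‖ ^ 2) =
      b i * b j * Real.exp (2 * ψ * inner ℝ (x i) (x j)) := fun i j => by
    have : -ψ * ‖x i - x j‖ ^ 2 =
        -ψ * ‖x i‖ ^ 2 + -ψ * ‖x j‖ ^ 2 + 2 * ψ * inner ℝ (x i) (x j) := by
      rw [norm_sub_sq_real]; ring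
    rw [this, Real.exp_add, Real.exp_add, hb]; ring
  simp_rw [h1]
  have h2 : HasSum (fun k : ℕ => ∑ i, ∑ j, b i * b j *
      ((2 * ψ * inner ℝ (x i) (x j)) ^ k / k.factorial))
      (∑ i, ∑ j, b i * b j * Real.exp (2 * ψ * inner ℝ (x i) (x j))) := by
    refine hasSum_sum fun i _ => hasSum_sum fun j _ => HasSum.mul_left _ ?_
    rw [Real.exp_eq_exp_ℝ]
    exact NormedSpace.expSeries_div_hasSum_exp _
  refine h2.nonneg fun k => ?_
  have h3 := (posSemidef_inner_pow x k).dotProduct_mulVec_nonneg b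
  have h4 : ∑ i, ∑ j, b i * b j * ((2 * ψ * inner ℝ (x i) (x j)) ^ k / k.factorial) =
      (2 * ψ) ^ k / k.factorial *
        (star b ⬝ᵥ ((Matrix.of fun i j => inner ℝ (x i) (x j) ^ k).mulVec b)) := by
    simp only [dotProduct, Matrix.mulVec, Finset.mul_sum, Matrix.of_apply, star_trivial]
    refine Finset.sum_congr rfl fun i _ => Finset.sum_congr rfl fun j _ => ?_
    rw [mul_pow]; ring
  rw [h4]
  positivity

/-- Truncation of a real number to `[-n, n]`. -/
def clip (n : ℕ) (x : ℝ) : ℝ := max (-n) (min n x)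

lemma measurable_clip (n : ℕ) : Measurable (clip n) := by unfold clip; fun_prop

lemma abs_clip_le (n : ℕ) (x : ℝ) : |clip n x| ≤ n := by
  have : (0 : ℝ) ≤ n := n.cast_nonneg
  rw [abs_le, clip]
  exact ⟨le_max_left _ _, max_le (by linarith) (min_le_left _ _)⟩

lemma clip_eq_self {n : ℕ} {x : ℝ} (h : |x| ≤ n) : clip n x = x := by
  rw [abs_le] at h
  rw [clip, min_eq_right h.2, max_eq_right h.1]

lemma clip_clip {m n : ℕ} (h : m ≤ n) (x : ℝ) : clip m (clip n x) = clip m x := by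
  have : (m : ℝ) ≤ n := Nat.cast_le.2 h
  have h0 : (0 : ℝ) ≤ m := m.cast_nonneg
  simp only [clip]
  grind

lemma edist_clip_le (n : ℕ) (x y : ℝ) : edist (clip n x) (clip n y) ≤ edist x y := by
  have : LipschitzWith 1 (clip n) := (LipschitzWith.id.const_min _).const_max _
  simpa using this x y

/-- A Gaussian kernel built on the squared `L²` distance of measurable functions is positive
definite, even though the functions need not be square integrable and the distances may be
infinite: truncation to `[-n, n]` places the functions in the Hilbert space `L²`, and the truncated
distances increase to the given ones. -/
theorem sum_expNeg_lintegral_nonneg {Ω ι : Type*} [MeasurableSpace Ω] (m : Measure Ω)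
    [IsFiniteMeasure m] [Fintype ι] {ψ : ℝ} (hψ : 0 < ψ) {f : ι → Ω → ℝ}
    (hf : ∀ i, Measurable (f i)) (a : ι → ℝ) :
    0 ≤ ∑ i, ∑ j, a i * a j * expNeg ψ (∫⁻ ω, edist (f i ω) (f j ω) ^ 2 ∂m) := by
  have hmem : ∀ n i, MemLp (fun ω => clip n (f i ω)) 2 m := fun n i =>
    MemLp.of_bound ((measurable_clip n).comp (hf i)).aestronglyMeasurable n
      (Eventually.of_forall fun ω => abs_clip_le n _)
  set c : ℕ → ι → ι → ℝ≥0∞ := fun n i j =>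
    ∫⁻ ω, edist (clip n (f i ω)) (clip n (f j ω)) ^ 2 ∂m with hc
  have hnorm : ∀ n i j, c n i j =
      ENNReal.ofReal (‖(hmem n i).toLp _ - (hmem n j).toLp _‖ ^ 2) := fun n i j => by
    rw [← MemLp.toLp_sub, Lp.norm_toLp, ← ENNReal.toReal_pow, ENNReal.ofReal_toReal
      (ENNReal.pow_ne_top ((hmem n i).sub (hmem n j)).eLpNorm_ne_top),
      eLpNorm_eq_lintegral_rpow_enorm_toReal (by norm_num) (by norm_num), ← ENNReal.rpow_natCast,
      ← ENNReal.rpow_mul]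
    simp [hc, edist_eq_enorm_sub]
  have hfin : ∀ n i j, c n i j ≠ ∞ := fun n i j => by
    rw [hnorm]; exact ENNReal.ofReal_ne_top
  have hlim : ∀ i j, Tendsto (fun n => c n i j) atTop
      (𝓝 (∫⁻ ω, edist (f i ω) (f j ω) ^ 2 ∂m)) := fun i j => by
    refine lintegral_tendsto_of_tendsto_of_monotone (fun n => ?_)
      (Eventually.of_forall fun ω p q hpq => ?_) (Eventually.of_forall fun ω => ?_)
    · have h1 := (measurable_clip n).comp (hf i)
      have h2 := (measurable_clip n).comp (hf j)
      exact ((h1.edist h2).pow_const 2).aemeasurable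
    · have := edist_clip_le p (clip q (f i ω)) (clip q (f j ω))
      rw [clip_clip hpq, clip_clip hpq] at this
      exact pow_le_pow_left' this 2
    · refine tendsto_const_nhds.congr' ?_
      obtain ⟨N, hN⟩ := exists_nat_ge (max |f i ω| |f j ω|)
      filter_upwards [eventually_ge_atTop N] with n hn
      have hn' : max |f i ω| |f j ω| ≤ n := hN.trans (Nat.cast_le.2 hn)
      rw [clip_eq_self ((le_max_left _ _).trans hn'), clip_eq_self ((le_max_right _ _).trans hn')]
  have hsum : Tendsto (fun n => ∑ i, ∑ j, a i * a j * expNeg ψ (c n i j)) atTop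
      (𝓝 (∑ i, ∑ j, a i * a j * expNeg ψ (∫⁻ ω, edist (f i ω) (f j ω) ^ 2 ∂m))) :=
    tendsto_finsetSum _ fun i _ => tendsto_finsetSum _ fun j _ =>
      (tendsto_expNeg hψ (fun n => hfin n i j) (hlim i j)).const_mul _
  refine ge_of_tendsto' hsum fun n => ?_
  have := sum_gaussian_nonneg hψ.le (fun i => (hmem n i).toLp _) a
  refine this.trans_eq (Finset.sum_congr rfl fun i _ => Finset.sum_congr rfl fun j _ => ?_)
  rw [expNeg, if_neg (hfin n i j), hnorm, ENNReal.toReal_ofReal (by positivity)]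

end Gaussian

/-! ### Kernels and their Hilbert spaces -/

section Reproducing

open RKHS

/-- The kernel `k` as a matrix of operators on `ℝ`. -/
def operatorMatrix {X : Type*} (k : X → X → ℝ) : Matrix X X (ℝ →L[ℝ] ℝ) :=
  Matrix.of fun s t => k s t • 1

lemma posSemidef_operatorMatrix {X : Type*} {k : X → X → ℝ} (hk : IsPositiveDefiniteKernel k) :
    (operatorMatrix k).PosSemidef := by
  refine ((posSemidef_tfae (K := operatorMatrix k)).out 0 2).2 (And.intro ?_ fun vv => ?_)
  · ext s t
    simp [operatorMatrix, hk.1 s t]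
  · have h := hk.2 vv.support.card (fun i => (vv.support.equivFin.symm i : X))
      (fun i => vv (vv.support.equivFin.symm i))
    have e : ∀ g : X → ℝ, ∑ i, g (vv.support.equivFin.symm i) = ∑ x ∈ vv.support, g x := fun g => by
      rw [Equiv.sum_comp vv.support.equivFin.symm (fun x => g (x : X)), Finset.sum_coe_sort]
    rw [e fun x => ∑ j, vv x * vv (vv.support.equivFin.symm j) *
      k x (vv.support.equivFin.symm j)] at h
    simp_rw [fun x => e fun y => vv x * vv y * k x y] at h
    refine h.trans_eq ?_
    simp only [Finsupp.sum, RCLike.re_to_real]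
    refine Finset.sum_congr rfl fun x _ => Finset.sum_congr rfl fun y _ => ?_
    simp [operatorMatrix, hk.1 y x]
    ring

/-- Moore's existence theorem for scalar kernels. -/
theorem exists_rkhs {X : Type} {k : X → X → ℝ} (hk : IsPositiveDefiniteKernel k) :
    ∃ (H : Type) (_ : NormedAddCommGroup H) (_ : InnerProductSpace ℝ H) (_ : CompleteSpace H)
      (_ : RKHS ℝ H X ℝ), HasReproducingKernel H k := by
  have : Fact (operatorMatrix k).PosSemidef := ⟨posSemidef_operatorMatrix hk⟩
  refine ⟨OfKernel (operatorMatrix k), inferInstance, inferInstance, inferInstance, inferInstance,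
    fun s t => ?_⟩
  rw [OfKernel.kernel_ofKernel]
  simp [operatorMatrix]

/-- Finite linear combinations of the kernel functions of a space of real functions. -/
def kerCombination {X : Type*} (H : Type*) [NormedAddCommGroup H] [InnerProductSpace ℝ H]
    [CompleteSpace H] [RKHS ℝ H X ℝ] : (X →₀ ℝ) →ₗ[ℝ] H :=
  Finsupp.linearCombination ℝ fun x => kerFun H x (1 : ℝ)

lemma denseRange_kerCombination {X : Type*} (H : Type*) [NormedAddCommGroup H]
    [InnerProductSpace ℝ H] [CompleteSpace H] [RKHS ℝ H X ℝ] :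
    DenseRange (kerCombination H : (X →₀ ℝ) → H) := by
  have h := kerFun_dense (𝕜 := ℝ) (X := X) (V := ℝ) H
  rw [← Submodule.dense_iff_topologicalClosure_eq_top] at h
  refine h.mono fun f hf => ?_
  refine (Submodule.span_le (p := LinearMap.range (kerCombination (X := X) H))).2 ?_ hf
  rintro _ ⟨x, v, rfl⟩
  refine ⟨Finsupp.single x v, ?_⟩
  rw [kerCombination, Finsupp.linearCombination_single, ← map_smul, smul_eq_mul, mul_one]

lemma norm_kerCombination_sq {X : Type*} (H : Type*) [NormedAddCommGroup H]
    [InnerProductSpace ℝ H] [CompleteSpace H] [RKHS ℝ H X ℝ] {k : X → X → ℝ}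
    (hk : HasReproducingKernel H k) (c : X →₀ ℝ) :
    ‖kerCombination H c‖ ^ 2 = c.sum fun x a => c.sum fun y b => a * (b * k y x) := by
  rw [← real_inner_self_eq_norm_sq, kerCombination, Finsupp.linearCombination_apply]
  simp only [Finsupp.sum, sum_inner, inner_sum, inner_smul_left, inner_smul_right,
    Finset.mul_sum]
  refine Finset.sum_congr rfl fun x _ => Finset.sum_congr rfl fun y _ => ?_
  have : inner ℝ (kerFun H x (1 : ℝ)) (kerFun H y (1 : ℝ)) = k y x := by
    rw [← kernel_inner, ← hk]
    simp
  rw [real_inner_comm, this, conj_trivial]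

/-- A space of functions is determined by its reproducing kernel: the isometry matches the
kernel functions, and evaluation at `s` is the inner product with the kernel function of `s`. -/
theorem exists_linearIsometryEquiv_of_hasReproducingKernel {X : Type*} {k : X → X → ℝ}
    (H₁ : Type*) (H₂ : Type*)
    [NormedAddCommGroup H₁] [InnerProductSpace ℝ H₁] [CompleteSpace H₁] [RKHS ℝ H₁ X ℝ]
    [NormedAddCommGroup H₂] [InnerProductSpace ℝ H₂] [CompleteSpace H₂] [RKHS ℝ H₂ X ℝ]
    (h₁ : HasReproducingKernel H₁ k) (h₂ : HasReproducingKernel H₂ k) :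
    ∃ e : H₁ ≃ₗᵢ[ℝ] H₂, ∀ (f : H₁) (s : X), (e f) s = f s := by
  have hnorm : ∀ c : X →₀ ℝ, ‖kerCombination H₂ c‖ = ‖kerCombination H₁ c‖ := fun c => by
    refine (sq_eq_sq₀ (norm_nonneg _) (norm_nonneg _)).1 ?_
    rw [norm_kerCombination_sq H₁ h₁, norm_kerCombination_sq H₂ h₂]
  let e : H₁ ≃ₗᵢ[ℝ] H₂ := (LinearEquiv.refl ℝ (X →₀ ℝ)).extendOfIsometry (kerCombination H₁)
    (kerCombination H₂) (denseRange_kerCombination H₁) (denseRange_kerCombination H₂) hnorm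
  have he : ∀ c : X →₀ ℝ, e (kerCombination H₁ c) = kerCombination H₂ c := fun c =>
    LinearEquiv.extendOfIsometry_eq _ _ _ _ _ _ _
  have hk : ∀ s : X, e (kerFun H₁ s (1 : ℝ)) = kerFun H₂ s (1 : ℝ) := fun s => by
    simpa [kerCombination] using he (Finsupp.single s 1)
  refine ⟨e, fun f s => ?_⟩
  have : inner ℝ (kerFun H₂ s (1 : ℝ)) (e f) = inner ℝ (kerFun H₁ s (1 : ℝ)) f := by
    rw [← hk, e.inner_map_map]
  simpa using this

end Reproducing

/-! ### The sliced Wasserstein kernel -/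

/-- The function on the product of the sphere and `(0, 1)` that represents `P`: the quantile
functions of all its slices. -/
def sliceQuantile {d : ℕ} (P : ContinuousProbabilityMeasure d)
    (z : Metric.sphere (0 : EuclideanSpace ℝ (Fin d)) 1 × ℝ) : ℝ :=
  quantile (slice P (z.1 : EuclideanSpace ℝ (Fin d))) z.2

lemma measurable_sliceQuantile {d : ℕ} (P : ContinuousProbabilityMeasure d) :
    Measurable (sliceQuantile P) :=
  have := isProbabilityMeasure_slice P
  measurable_quantile_family
    (fun v : Metric.sphere (0 : EuclideanSpace ℝ (Fin d)) 1 =>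
      slice P (v : EuclideanSpace ℝ (Fin d))) (measurable_slice_Iic P)

lemma slicedWassersteinSq_eq_lintegral {d : ℕ} (P Q : ContinuousProbabilityMeasure d) :
    slicedWassersteinSq P Q = ∫⁻ z, edist (sliceQuantile P z) (sliceQuantile Q z) ^ 2
      ∂((volume : Measure (EuclideanSpace ℝ (Fin d))).toSphere.prod
        (volume.restrict (Set.Ioo (0 : ℝ) 1))) := by
  have hP := isProbabilityMeasure_slice P
  have hQ := isProbabilityMeasure_slice Q
  rw [lintegral_prod _ (((measurable_sliceQuantile P).edist
    (measurable_sliceQuantile Q)).pow_const 2).aemeasurable]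
  exact lintegral_congr fun v => wassersteinSq_eq_lintegral_quantile _ _

lemma isPositiveDefiniteKernel_kernel {d : ℕ} {ψ : ℝ} (hψ : 0 < ψ)
    (S : Set (ContinuousProbabilityMeasure d)) :
    IsPositiveDefiniteKernel (fun s t : S => kernel ψ s.1 t.1) := by
  have hk : ∀ P Q : ContinuousProbabilityMeasure d,
      kernel ψ P Q = expNeg ψ (slicedWassersteinSq P Q) := fun _ _ => rfl
  refine ⟨fun s t => ?_, fun N s a => ?_⟩
  · simp only [hk, slicedWassersteinSq_eq_lintegral, edist_comm]
  · simp only [hk, slicedWassersteinSq_eq_lintegral]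
    exact sum_expNeg_lintegral_nonneg _ hψ (fun i => measurable_sliceQuantile (s i).1) a

end SWG

end

theorem mainTheorem2 (d : ℕ) (ψ : ℝ) (hψ : 0 < ψ)
    (S : Set (SWG.ContinuousProbabilityMeasure d)) :
    SWG.IsPositiveDefiniteKernel (fun s t : S => SWG.kernel ψ s.1 t.1) ∧
    (∃ (H : Type) (_ : NormedAddCommGroup H) (_ : InnerProductSpace ℝ H) (_ : CompleteSpace H)
      (_ : RKHS ℝ H S ℝ),
      SWG.HasReproducingKernel H (fun s t : S => SWG.kernel ψ s.1 t.1)) ∧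
    (∀ (H₁ : Type*) (H₂ : Type*)
      [NormedAddCommGroup H₁] [InnerProductSpace ℝ H₁] [CompleteSpace H₁] [RKHS ℝ H₁ S ℝ]
      [NormedAddCommGroup H₂] [InnerProductSpace ℝ H₂] [CompleteSpace H₂] [RKHS ℝ H₂ S ℝ],
      SWG.HasReproducingKernel H₁ (fun s t : S => SWG.kernel ψ s.1 t.1) →
      SWG.HasReproducingKernel H₂ (fun s t : S => SWG.kernel ψ s.1 t.1) →
      ∃ e : H₁ ≃ₗᵢ[ℝ] H₂, ∀ (f : H₁) (s : S), (e f) s = f s) :=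
  ⟨SWG.isPositiveDefiniteKernel_kernel hψ S,
    SWG.exists_rkhs (SWG.isPositiveDefiniteKernel_kernel hψ S),
    fun H₁ H₂ => SWG.exists_linearIsometryEquiv_of_hasReproducingKernel H₁ H₂⟩
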